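/- Let $K$ be an algebraically closed field of characteristic zero (for instance $K=\mathbb{C}$), let $A,B,C$ be finite-dimensional $K$-vector spaces, and regard a tensor $T\in A\otimes B\otimes C$ as a trilinear function $T:A^*\times B^*\times C^*\to K$. Its geometric rank is $$\mathrm{GR}(T):=\mathrm{codim}\{(x,y)\in A^*\times B^*\mid T(x,y,z)=0\ \text{for all } z\in C^*\},$$ the codimension being that of a Zariski closed subset of the affine space $A^*\times B^*$. Its multilinear ranks $\mathrm{ml}_A(T),\mathrm{ml}_B(T),\mathrm{ml}_C(T)$ are the ranks of the associated linear maps $A^*\to B\otimes C$, $B^*\to A\otimes C$, $C^*\to A\otimes B$, and its slice rank is $$\mathrm{SR}(T):=\min\{\mathrm{ml}_A(T_1)+\mathrm{ml}_B(T_2)+\mathrm{ml}_C(T_3)\mid T=T_1+T_2+T_3\}.$$ Call $T$ a compression tensor if $\mathrm{GR}(T)=\mathrm{SR}(T)$, and call $T$ primitive if it cannot be written as $T=X+Y$ with $X,Y\in A\otimes B\otimes C$, $\mathrm{GR}(X)=\mathrm{GR}(T)-1$ and $\mathrm{GR}(Y)=1$. If $T\in A\otimes B\otimes C$ satisfies $\mathrm{GR}(T)<\mathrm{SR}(T)$,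 then there exist a primitive tensor $T_p\in A\otimes B\otimes C$ and a compression tensor $T_c\in A\otimes B\otimes C$ such that $T=T_p+T_c$ and $\mathrm{GR}(T_p)+\mathrm{GR}(T_c)=\mathrm{GR}(T)$. -/

import Mathlib

open scoped TensorProduct

noncomputable section

namespace Tripartite

section Codimension

variable (K V : Type*) [Field K] [AddCommGroup V] [Module K V]

/-- The ring `K[V]` of polynomial functions on a vector space `V` (its coordinate ring as an affine
space, when `K` is infinite and `V` is finite-dimensional): the algebra of functions `V → K`
generated by the linear forms on `V`. -/
def polyFun : Subalgebra K (V → K) :=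
  Algebra.adjoin K (Set.range fun φ : Module.Dual K V => (φ : V → K))

variable {V}

/-- The ideal of `K[V]` of the polynomial functions that vanish on `S`. -/
def idealOf (S : Set V) : Ideal (polyFun K V) where
  carrier := {f | ∀ v ∈ S, (f : V → K) v = 0}
  zero_mem' := fun _ _ => rfl
  add_mem' := fun {f g} hf hg v hv => by
    simp only [Set.mem_ofPred_eq] at hf hg
    simp [hf v hv, hg v hv]
  smul_mem' := fun c f hf v hv => by
    simp only [Set.mem_ofPred_eq] at hf
    simp [hf v hv]

/-- The codimension of a Zariski-closed subset `S` of the affine space `V`: the height of its ideal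
in `K[V]`, i.e. the minimum over the irreducible components `Z` of `S` of the maximal length of a
chain of irreducible closed subsets from `Z` up to `V`. For `V` of finite dimension over an
algebraically closed field and `S` non-empty this equals `dim V - dim S`. -/
def codim (S : Set V) : ℕ∞ :=
  (idealOf K S).height

end Codimension

section Tensors

variable {K A B C : Type*} [Field K]
  [AddCommGroup A] [Module K A] [AddCommGroup B] [Module K B] [AddCommGroup C] [Module K C]

/-- The value `T(x, y, z)` of a tensor seen as a trilinear function on `A* × B* × C*`; on
`a ⊗ b ⊗ c` it is `x(a) y(b) z(c)`. -/
def value (T : A ⊗[K] (B ⊗[K] C)) (x : Module.Dual K A) (y : Module.Dual K B)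
    (z : Module.Dual K C) : K :=
  TensorProduct.dualDistrib K A (B ⊗[K] C) (x ⊗ₜ TensorProduct.dualDistrib K B C (y ⊗ₜ z)) T

/-- The geometric rank: the codimension in `A* × B*` of the set of the pairs `(x, y)` such that
`T(x, y, z) = 0` for all `z` in `C*`. -/
def geometricRank (T : A ⊗[K] (B ⊗[K] C)) : ℕ∞ :=
  codim K {p : Module.Dual K A × Module.Dual K B | ∀ z : Module.Dual K C, value T p.1 p.2 z = 0}

/-- The flattening `T_A : A* → B ⊗ C`, sending `x` to the contraction of `T` with `x`. -/
def flatA (T : A ⊗[K] (B ⊗[K] C)) : Module.Dual K A →ₗ[K] B ⊗[K] C where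
  toFun x := TensorProduct.lid K (B ⊗[K] C) (LinearMap.rTensor (B ⊗[K] C) x T)
  map_add' x y := by simp [LinearMap.rTensor_add]
  map_smul' c x := by simp [LinearMap.rTensor_smul]

/-- The flattening `T_B : B* → A ⊗ C`. -/
def flatB (T : A ⊗[K] (B ⊗[K] C)) : Module.Dual K B →ₗ[K] A ⊗[K] C where
  toFun y := LinearMap.lTensor A (TensorProduct.lid K C).toLinearMap
    (LinearMap.lTensor A (LinearMap.rTensor C y) T)
  map_add' x y := by simp [LinearMap.rTensor_add, LinearMap.lTensor_add]
  map_smul' c x := by simp [LinearMap.rTensor_smul, LinearMap.lTensor_smul]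

/-- The flattening `T_C : C* → A ⊗ B`. -/
def flatC (T : A ⊗[K] (B ⊗[K] C)) : Module.Dual K C →ₗ[K] A ⊗[K] B where
  toFun z := LinearMap.lTensor A (TensorProduct.rid K B).toLinearMap
    (LinearMap.lTensor A (LinearMap.lTensor B z) T)
  map_add' x y := by simp [LinearMap.lTensor_add]
  map_smul' c x := by simp [LinearMap.lTensor_smul]

/-- The multilinear rank `ml_A(T) = rank(T_A)`. -/
def mlA (T : A ⊗[K] (B ⊗[K] C)) : ℕ := Module.finrank K (LinearMap.range (flatA T))

/-- The multilinear rank `ml_B(T) = rank(T_B)`. -/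
def mlB (T : A ⊗[K] (B ⊗[K] C)) : ℕ := Module.finrank K (LinearMap.range (flatB T))

/-- The multilinear rank `ml_C(T) = rank(T_C)`. -/
def mlC (T : A ⊗[K] (B ⊗[K] C)) : ℕ := Module.finrank K (LinearMap.range (flatC T))

/-- The slice rank: the minimum of `ml_A(T₁) + ml_B(T₂) + ml_C(T₃)` over all `T = T₁ + T₂ + T₃`. -/
def sliceRank (T : A ⊗[K] (B ⊗[K] C)) : ℕ :=
  sInf {n | ∃ T₁ T₂ T₃ : A ⊗[K] (B ⊗[K] C), T = T₁ + T₂ + T₃ ∧ n = mlA T₁ + mlB T₂ + mlC T₃}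

/-- `T` is compression of geometric rank `r`. -/
def IsCompressionOfRank (T : A ⊗[K] (B ⊗[K] C)) (r : ℕ) : Prop :=
  geometricRank T = r ∧ sliceRank T = r

/-- `T` is primitive of geometric rank `r`: it has geometric rank `r` and is not of the form `X + Y`
with `X` of geometric rank `r - 1` and `Y` of geometric rank `1`. -/
def IsPrimitiveOfRank (T : A ⊗[K] (B ⊗[K] C)) (r : ℕ) : Prop :=
  geometricRank T = r ∧
    ¬ ∃ X Y : A ⊗[K] (B ⊗[K] C), T = X + Y ∧ geometricRank X + 1 = r ∧ geometricRank Y = 1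

/-- `T` is compression (of some geometric rank). -/
def IsCompression (T : A ⊗[K] (B ⊗[K] C)) : Prop := ∃ r : ℕ, IsCompressionOfRank T r

/-- `T` is primitive (of some geometric rank). -/
def IsPrimitive (T : A ⊗[K] (B ⊗[K] C)) : Prop := ∃ r : ℕ, IsPrimitiveOfRank T r

end Tensors

end Tripartite

end

/-! Split off summands of geometric rank one for as long as the remaining tensor is not primitive.
Each split lowers the geometric rank by exactly one, so after `k` steps `T = Tp + Tc` with `Tp`
primitive, `GR(Tp) = GR(T) - k`, and `Tc` a sum of `k` tensors of geometric rank one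
(`exists_isPrimitive_add`). Three facts then force `GR(Tc) = SR(Tc) = k`.

Tensors with `GR = 1` have `SR ≤ 1`, so `SR(Tc) ≤ k`: a height-one prime of a polynomial ring is
principal, hence the forms `T(·, ·, z)` share an irreducible factor, and its bidegree shows which
flattening has rank one.

Geometric rank is subadditive, so `GR(Tc) ≥ k`. This is the affine dimension theorem, proved by
intersecting a product with the diagonal. It needs a common point of the two varieties, and the
origin serves because the equations are homogeneous.

Finally `GR ≤ SR`: by subadditivity only the bounds `GR ≤ ml` remain, and these come from Krull's
height theorem. -/

namespace Ideal

/-! ### Heights of ideals along ring homomorphisms. -/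

variable {R S : Type*} [CommRing R] [CommRing S]

theorem height_le_height_comap_of_surjective (f : R →+* S) (hf : Function.Surjective f)
    (P : Ideal S) [P.IsPrime] : P.height ≤ (P.comap f).height := by
  have h := Order.height_le_height_apply_of_strictMono (PrimeSpectrum.comap f)
    (RingHom.strictMono_comap_of_surjective hf) ⟨P, inferInstance⟩
  rw [← PrimeSpectrum.height_eq_orderHeight, ← PrimeSpectrum.height_eq_orderHeight] at h
  exact h

/-- A chain of primes below the preimage of `P` can be started at a prime above `ker f`. -/
theorem exists_isPrime_height_add_le_of_surjective [IsNoetherianRing R] (f : R →+* S)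
    (hf : Function.Surjective f) (P : Ideal S) [P.IsPrime] [P.FiniteHeight] :
    ∃ P₀ : Ideal R, P₀.IsPrime ∧ RingHom.ker f ≤ P₀ ∧
      P₀.height + P.height ≤ (P.comap f).height := by
  obtain ⟨l, hl, hlen⟩ := P.exists_ltSeries_length_eq_height
  let l' : LTSeries (PrimeSpectrum R) :=
    l.map (PrimeSpectrum.comap f) (RingHom.strictMono_comap_of_surjective hf)
  refine ⟨l'.head.asIdeal, l'.head.isPrime, ?_, ?_⟩
  · rw [LTSeries.head_map]
    exact Ideal.comap_mono bot_le
  · obtain ⟨m, hm, hmlen⟩ := l'.head.asIdeal.exists_ltSeries_length_eq_height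
    have hlast : l'.last = PrimeSpectrum.comap f ⟨P, inferInstance⟩ := by
      rw [LTSeries.last_map, hl]
    -- A maximal chain ending at the lowest prime of `l'` is glued to `l'`, so the lengths add.
    have h := Order.length_le_height_last (p := m.smash l' hm)
    rw [RelSeries.last_smash, hlast, ← PrimeSpectrum.height_eq_orderHeight] at h
    rw [← hlen, ← hmlen]
    exact_mod_cast h

theorem height_radical (I : Ideal R) : I.radical.height = I.height := by
  rw [height_eq_inf_minimalPrimes, height_eq_inf_minimalPrimes, radical_minimalPrimes]

theorem height_le_height_of_liesOver_of_hasGoingDown [Algebra R S] [IsNoetherianRing R]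
    [IsNoetherianRing S] [Algebra.HasGoingDown R S] (p : Ideal R) [p.IsPrime] (P : Ideal S) [P.IsPrime]
    [P.LiesOver p] : p.height ≤ P.height := by
  rw [height_eq_height_add_of_liesOver_of_hasGoingDown p P]
  exact le_self_add

end Ideal

/-! ### Maximal ideals of polynomial rings. -/

namespace MvPolynomial

open Polynomial in
-- Induction on the variables: since a polynomial ring over a field is Jacobson, a maximal ideal
-- contracts to a maximal ideal in one variable fewer, and the height drops by exactly one.
theorem height_eq_of_isMaximal {K : Type*} [Field K] (n : ℕ) (M : Ideal (MvPolynomial (Fin n) K))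
    [hM : M.IsMaximal] : M.height = n := by
  induction n with
  | zero =>
    have := (MvPolynomial.isEmptyRingEquiv K (Fin 0)).toMulEquiv.isField (Field.toIsField K)
    let _ := this.toField
    have : M = ⊥ := (Ideal.eq_bot_or_top M).resolve_right hM.ne_top
    simp [this]
  | succ n ih =>
    let e := (finSuccEquiv K n).toRingEquiv
    have h := Ideal.comap_isMaximal_of_equiv e.symm (p := M)
    set P := M.comap e.symm
    have h1 : P.height = M.height := e.symm.height_comap M
    have h2 := Polynomial.isMaximal_comap_C_of_isJacobsonRing P
    have hover : P.LiesOver (P.under (MvPolynomial (Fin n) K)) := ⟨rfl⟩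
    have h3 := Polynomial.height_eq_height_add_one (P.under (MvPolynomial (Fin n) K)) P
    rw [← h1, h3]
    have := ih (P.under (MvPolynomial (Fin n) K)) (hM := h2)
    rw [this]
    simp

end MvPolynomial

/-! ### Dimension formula for quotients of polynomial rings by primes. -/

section Trdeg

open Algebra

/-- Every prime of `R` has height at least `n` minus the transcendence degree of its residue
domain. -/
def CoheightTrdeg (K R : Type*) [Field K] [CommRing R] [Algebra K R] (n : ℕ) : Prop :=
  ∀ p : Ideal R, p.IsPrime → ∃ s : ℕ, (s : Cardinal) ≤ trdeg K (R ⧸ p) ∧ (n : ℕ∞) ≤ p.height + s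

variable {K : Type*} [Field K]

theorem CoheightTrdeg.of_algEquiv {R S : Type*} [CommRing R] [Algebra K R] [CommRing S]
    [Algebra K S] (e : R ≃ₐ[K] S) {n : ℕ} (h : CoheightTrdeg K R n) : CoheightTrdeg K S n := by
  intro p hp
  obtain ⟨s, hs, hn⟩ := h (p.comap (e : R →+* S)) inferInstance
  refine ⟨s, ?_, ?_⟩
  · have := (Ideal.quotientEquivAlg (p.comap (e : R →+* S)) p e
      (Ideal.map_comap_of_surjective _ e.surjective p).symm).lift_trdeg_eq
    have h2 : Cardinal.lift (s : Cardinal) ≤ Cardinal.lift (trdeg K (R ⧸ p.comap (e : R →+* S))) :=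
      Cardinal.lift_le.2 hs
    rw [this] at h2
    simpa using h2
  · have := e.toRingEquiv.height_comap p
    rw [← this]; exact hn

/-- Let `p` be the contraction of `Q`. If `Q` is the extension of `p`, its residue domain is `(R ⧸
p)[X]` and the transcendence degree gains one. Otherwise `Q` lies strictly above that extension and
the height gains one. -/
theorem CoheightTrdeg.polynomial {R : Type*} [CommRing R] [IsNoetherianRing R] [Algebra K R]
    {n : ℕ} (h : CoheightTrdeg K R n) : CoheightTrdeg K (Polynomial R) (n + 1) := by
  intro Q hQ
  obtain ⟨s, hs, hn⟩ := h (Q.under R) inferInstance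
  set p := Q.under R with hp
  have hle : p.map Polynomial.C ≤ Q := Ideal.map_comap_le
  have hpr : (p.map Polynomial.C).IsPrime := Ideal.isPrime_map_C_of_isPrime
  have hover : (p.map Polynomial.C).LiesOver p :=
    ⟨le_antisymm Ideal.le_comap_map (Ideal.comap_mono hle)⟩
  have hht := Ideal.height_le_height_of_liesOver_of_hasGoingDown p (p.map Polynomial.C)
  obtain heq | hlt := hle.eq_or_lt
  · refine ⟨s + 1, ?_, ?_⟩
    · rw [← heq]
      let e := Ideal.polynomialQuotientEquivQuotientPolynomial p
      have he : ∀ r : K, e (algebraMap K _ r) = algebraMap K _ r := fun r => by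
        have h := Ideal.polynomialQuotientEquivQuotientPolynomial_map_mk p
          (Polynomial.C (algebraMap K R r))
        rw [Polynomial.map_C] at h
        exact h
      let f : Polynomial (R ⧸ p) →ₐ[K] Polynomial R ⧸ p.map Polynomial.C :=
        { e.toRingHom with commutes' := he }
      refine le_trans ?_ (trdeg_le_of_injective f e.injective)
      rw [← trdeg_add_eq K (R ⧸ p), Polynomial.trdeg_of_isDomain]
      push_cast
      gcongr
    · rw [← heq]
      push_cast
      rw [← add_assoc]
      gcongr
      exact hn.trans (by gcongr)
  · refine ⟨s, ?_, ?_⟩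
    · refine hs.trans ?_
      refine trdeg_le_of_injective (Ideal.quotientMapₐ Q (IsScalarTower.toAlgHom K R _) le_rfl) ?_
      exact Ideal.quotientMap_injective
    · have := Ideal.height_add_one_le_of_lt_of_isPrime hlt
      calc ((n + 1 : ℕ) : ℕ∞) = n + 1 := by push_cast; rfl
        _ ≤ (p.height + s) + 1 := by gcongr
        _ ≤ ((p.map Polynomial.C).height + s) + 1 := by gcongr
        _ = ((p.map Polynomial.C).height + 1) + s := by ring
        _ ≤ _ := by gcongr

theorem coheightTrdeg_mvPolynomial (n : ℕ) : CoheightTrdeg K (MvPolynomial (Fin n) K) n := by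
  induction n with
  | zero => exact fun p hp => ⟨0, by simp, by simp⟩
  | succ n ih => exact ih.polynomial.of_algEquiv (MvPolynomial.finSuccEquiv K n).symm

/-- By Noether normalization the quotient by `Q` is integral over a polynomial ring in `t`
variables, with `t` its transcendence degree. Going-down bounds the height of the image of `M` below
by that of its contraction, a maximal ideal of height `t`. -/
theorem MvPolynomial.le_height_add_height_map_quotient {n : ℕ}
    (Q M : Ideal (MvPolynomial (Fin n) K)) [Q.IsPrime] [hM : M.IsMaximal] (hQM : Q ≤ M) :
    (n : ℕ∞) ≤ Q.height + (M.map (Ideal.Quotient.mk Q)).height := by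
  obtain ⟨s, hs, hn⟩ := coheightTrdeg_mvPolynomial (K := K) n Q inferInstance
  obtain ⟨t, -, g, hg, hint⟩ := exists_integral_inj_algHom_of_quotient Q (Ideal.IsPrime.ne_top ‹_›)
  let _ := g.toRingHom.toAlgebra
  have : IsScalarTower K (MvPolynomial (Fin t) K) (MvPolynomial (Fin n) K ⧸ Q) :=
    IsScalarTower.of_algHom g
  have : Algebra.IsIntegral (MvPolynomial (Fin t) K) (MvPolynomial (Fin n) K ⧸ Q) := ⟨hint⟩
  have : FaithfulSMul (MvPolynomial (Fin t) K) (MvPolynomial (Fin n) K ⧸ Q) :=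
    (faithfulSMul_iff_algebraMap_injective _ _).2 hg
  have ht : trdeg K (MvPolynomial (Fin n) K ⧸ Q) = t := by
    rw [← trdeg_add_eq K (MvPolynomial (Fin t) K), MvPolynomial.trdeg_of_isDomain,
      trdeg_eq_zero (R := MvPolynomial (Fin t) K)]
    simp
  rw [ht] at hs
  have hst : s ≤ t := by exact_mod_cast hs
  set M' := M.map (Ideal.Quotient.mk Q) with hM'
  have : M'.IsMaximal := Ideal.IsMaximal.map_of_surjective_of_ker_le Ideal.Quotient.mk_surjective
    (by simpa using hQM)
  have : (M'.under (MvPolynomial (Fin t) K)).IsMaximal :=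
    Ideal.isMaximal_comap_of_isIntegral_of_isMaximal M'
  have h1 := Ideal.height_le_height_of_liesOver_of_hasGoingDown
    (M'.under (MvPolynomial (Fin t) K)) M'
  rw [MvPolynomial.height_eq_of_isMaximal] at h1
  calc (n : ℕ∞) ≤ Q.height + s := hn
    _ ≤ Q.height + t := by gcongr
    _ ≤ _ := by gcongr

end Trdeg

/-! ### The affine dimension theorem by reduction to the diagonal. -/

section Diagonal

variable {K R : Type*} [Field K] [CommRing R] [Algebra K R]

/-- The fibre of `B ⊗ C` over a rational point of `B` is `C`. -/
theorem height_add_height_le_height_ker_productMap {B C : Type*} [CommRing B] [CommRing C]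
    [Algebra K B] [Algebra K C] [IsNoetherianRing B] [IsNoetherianRing (B ⊗[K] C)]
    (β : B →ₐ[K] K) (γ : C →ₐ[K] K) :
    (RingHom.ker β).height + (RingHom.ker γ).height ≤
      (RingHom.ker (Algebra.TensorProduct.productMap β γ)).height := by
  set M := RingHom.ker (Algebra.TensorProduct.productMap β γ) with hM
  have hMp : M.IsPrime := RingHom.ker_isPrime _
  have hBp : (RingHom.ker β).IsPrime := RingHom.ker_isPrime _
  have hCp : (RingHom.ker γ).IsPrime := RingHom.ker_isPrime _
  have hover : M.LiesOver (RingHom.ker β) := by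
    refine ⟨?_⟩
    ext b
    simp [hM, Ideal.under_def, RingHom.mem_ker]
  rw [Ideal.height_eq_height_add_of_liesOver_of_hasGoingDown (RingHom.ker β) M]
  gcongr
  set J := (RingHom.ker β).map (algebraMap B (B ⊗[K] C)) with hJ
  -- Evaluating the factor `B` at `β` maps the fibre ring onto `C`, so chains of primes of `C` pull
  -- back to the fibre.
  let π : B ⊗[K] C →ₐ[K] C :=
    Algebra.TensorProduct.productMap ((Algebra.ofId K C).comp β) (AlgHom.id K C)
  have hπγ : γ.comp π = Algebra.TensorProduct.productMap β γ := by
    ext <;> simp [π, Algebra.ofId_apply]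
  have hπJ : ∀ t ∈ J, π.toRingHom t = 0 := by
    intro t ht
    have : J ≤ RingHom.ker π.toRingHom := by
      rw [hJ, Ideal.map_le_iff_le_comap]
      intro b hb
      have hb' : β b = 0 := hb
      simp [RingHom.mem_ker, π, hb', Algebra.ofId_apply]
    exact this ht
  let π' := Ideal.Quotient.lift J π.toRingHom hπJ
  have hπ' : Function.Surjective π' := by
    intro c
    exact ⟨Ideal.Quotient.mk J (1 ⊗ₜ c), by simp [π', π]⟩
  refine (Ideal.height_le_height_comap_of_surjective π' hπ' (RingHom.ker γ)).trans
    (Ideal.height_mono ?_)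
  intro y hy
  obtain ⟨t, rfl⟩ := Ideal.Quotient.mk_surjective y
  apply Ideal.mem_map_of_mem
  rw [hM, RingHom.mem_ker, ← hπγ]
  exact hy

theorem MvPolynomial.height_le_of_isPrime {n : ℕ} (P : Ideal (MvPolynomial (Fin n) K))
    [P.IsPrime] : P.height ≤ n := by
  have := Ideal.height_le_ringKrullDim_of_isPrime (I := P)
  rw [MvPolynomial.ringKrullDim_of_isNoetherianRing, ringKrullDim_eq_zero_of_field] at this
  rw [zero_add, Nat.card_fin] at this
  exact_mod_cast this

open MvPolynomial in
/-- Cutting `Spec B × Spec C` with the diagonal of affine `n`-space lowers its dimension at a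
rational point by at most `n`. -/
theorem exists_isPrime_height_add_height_ker_productMap_le {n : ℕ} {B C : Type*} [CommRing B]
    [CommRing C] [Algebra K B] [Algebra K C] [IsNoetherianRing (B ⊗[K] C)]
    (b : MvPolynomial (Fin n) K →ₐ[K] B) (c : MvPolynomial (Fin n) K →ₐ[K] C)
    (hb : Function.Surjective b) (hc : Function.Surjective c) (β : B →ₐ[K] K) (γ : C →ₐ[K] K)
    (hβγ : β.comp b = γ.comp c) :
    ∃ P : Ideal (MvPolynomial (Fin n) K), P.IsPrime ∧ RingHom.ker b ⊔ RingHom.ker c ≤ P ∧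
      P.height + (RingHom.ker (Algebra.TensorProduct.productMap β γ)).height ≤ n + n := by
  set M := RingHom.ker (Algebra.TensorProduct.productMap β γ) with hM
  have hMp : M.IsPrime := RingHom.ker_isPrime _
  -- The `n` equations of the diagonal; dividing by them costs at most `n` in height.
  let δ : Fin n → B ⊗[K] C := fun i => b (X i) ⊗ₜ 1 - 1 ⊗ₜ c (X i)
  have hδ : Set.range δ ⊆ M := by
    rintro _ ⟨i, rfl⟩
    have h : β (b (X i)) = γ (c (X i)) := DFunLike.congr_fun hβγ (X i)
    simp [δ, hM, RingHom.mem_ker, h]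
  have h4 := Ideal.height_le_height_add_encard_of_subset (Set.range δ) hδ
  have h5 : (Set.range δ).encard ≤ n := by
    rw [← Set.image_univ]
    refine (Set.encard_image_le _ _).trans ?_
    simp [Set.encard_univ]
  set I := Ideal.span (Set.range δ) with hI
  let f : MvPolynomial (Fin n) K →ₐ[K] (B ⊗[K] C) ⧸ I :=
    ((Ideal.Quotient.mkₐ K I).comp Algebra.TensorProduct.includeLeft).comp b
  let f' : MvPolynomial (Fin n) K →ₐ[K] (B ⊗[K] C) ⧸ I :=
    ((Ideal.Quotient.mkₐ K I).comp Algebra.TensorProduct.includeRight).comp c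
  -- On the diagonal the two coordinate systems agree, so the quotient is generated by one copy of
  -- the variables and is a quotient of the polynomial ring.
  have hff' : f = f' :=
    MvPolynomial.algHom_ext fun i => Ideal.Quotient.eq.2 (Ideal.subset_span ⟨i, rfl⟩)
  have hfs : Function.Surjective f := by
    intro y
    obtain ⟨t, rfl⟩ := Ideal.Quotient.mk_surjective y
    induction t using TensorProduct.induction_on with
    | zero => exact ⟨0, by simp⟩
    | add s t hs ht =>
      obtain ⟨x, hx⟩ := hs
      obtain ⟨y, hy⟩ := ht
      exact ⟨x + y, by rw [map_add, map_add, hx, hy]⟩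
    | tmul x y =>
      obtain ⟨r, rfl⟩ := hb x
      obtain ⟨s, rfl⟩ := hc y
      refine ⟨r * s, ?_⟩
      have h : f s = f' s := by rw [hff']
      have h' : f r * f' s = Ideal.Quotient.mk I ((b r ⊗ₜ 1) * (1 ⊗ₜ c s)) := by
        rw [map_mul]; rfl
      rw [map_mul, h, h']
      simp
  set N := M.map (Ideal.Quotient.mk I) with hN
  have hIM : I ≤ M := Ideal.span_le.2 hδ
  have hNp : N.IsPrime := Ideal.isPrime_map_quotientMk_of_isPrime hIM
  obtain ⟨P, hP, hker, hle⟩ :=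
    Ideal.exists_isPrime_height_add_le_of_surjective f.toRingHom hfs N
  refine ⟨P, hP, (sup_le ?_ ?_).trans hker, ?_⟩
  · intro r hr
    have h : b r = 0 := hr
    simp [RingHom.mem_ker, f, h]
  · intro r hr
    have h : c r = 0 := hr
    rw [hff']
    simp [RingHom.mem_ker, f', h]
  · calc P.height + M.height ≤ P.height + (N.height + n) := by
          gcongr; exact h4.trans (by gcongr)
      _ = (P.height + N.height) + n := by ring
      _ ≤ n + n := by gcongr; exact hle.trans (height_le_of_isPrime _)

open MvPolynomial in
-- With `M` the point `(β, γ)` of the product: `n ≤ ht p + ht (ker β)`, `n ≤ ht q + ht (ker γ)`, `ht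
-- (ker β) + ht (ker γ) ≤ ht M` and `ht P + ht M ≤ 2n`. Together these give the bound on `ht P`.
theorem exists_isPrime_sup_le_height_le_fin {n : ℕ} (ε : MvPolynomial (Fin n) K →ₐ[K] K)
    (p q : Ideal (MvPolynomial (Fin n) K)) [p.IsPrime] [q.IsPrime]
    (hp : p ≤ RingHom.ker ε) (hq : q ≤ RingHom.ker ε) :
    ∃ P : Ideal (MvPolynomial (Fin n) K), P.IsPrime ∧ p ⊔ q ≤ P ∧
      P.height ≤ p.height + q.height := by
  have hεs : Function.Surjective ε := fun c => ⟨algebraMap K _ c, by simp⟩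
  have hεm : (RingHom.ker ε).IsMaximal := RingHom.ker_isMaximal_of_surjective ε hεs
  let β := Ideal.Quotient.liftₐ p ε hp
  let γ := Ideal.Quotient.liftₐ q ε hq
  have hβ : RingHom.ker β = (RingHom.ker ε).map (Ideal.Quotient.mk p) :=
    Ideal.ker_quotient_lift ε.toRingHom hp
  have hγ : RingHom.ker γ = (RingHom.ker ε).map (Ideal.Quotient.mk q) :=
    Ideal.ker_quotient_lift ε.toRingHom hq
  have h1 := le_height_add_height_map_quotient p _ hp
  have h2 := le_height_add_height_map_quotient q _ hq
  rw [← hβ] at h1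
  rw [← hγ] at h2
  have hnoeth : IsNoetherianRing
      ((MvPolynomial (Fin n) K ⧸ p) ⊗[K] (MvPolynomial (Fin n) K ⧸ q)) :=
    Algebra.FiniteType.isNoetherianRing (MvPolynomial (Fin n) K ⧸ p)
      ((MvPolynomial (Fin n) K ⧸ p) ⊗[K] (MvPolynomial (Fin n) K ⧸ q))
  have h3 := height_add_height_le_height_ker_productMap β γ
  obtain ⟨P, hP, hle, h4⟩ := exists_isPrime_height_add_height_ker_productMap_le
    (Ideal.Quotient.mkₐ K p) (Ideal.Quotient.mkₐ K q) (Ideal.Quotient.mkₐ_surjective K p)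
    (Ideal.Quotient.mkₐ_surjective K q) β γ rfl
  have hker : ∀ I : Ideal (MvPolynomial (Fin n) K), RingHom.ker (Ideal.Quotient.mkₐ K I) = I :=
    fun I => Ideal.mk_ker
  rw [hker, hker] at hle
  refine ⟨P, hP, hle, ?_⟩
  have hbp : (RingHom.ker β).IsPrime := RingHom.ker_isPrime _
  have hcp : (RingHom.ker γ).IsPrime := RingHom.ker_isPrime _
  obtain ⟨a1, e1⟩ := ENat.ne_top_iff_exists.1 p.height_ne_top_of_isPrime
  obtain ⟨a2, e2⟩ := ENat.ne_top_iff_exists.1 q.height_ne_top_of_isPrime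
  obtain ⟨a3, e3⟩ := ENat.ne_top_iff_exists.1 P.height_ne_top_of_isPrime
  obtain ⟨a5, e5⟩ := ENat.ne_top_iff_exists.1 (RingHom.ker β).height_ne_top_of_isPrime
  obtain ⟨a6, e6⟩ := ENat.ne_top_iff_exists.1 (RingHom.ker γ).height_ne_top_of_isPrime
  have h5 := (add_le_add_right h3 P.height).trans h4
  rw [← e3, ← e5, ← e6] at h5
  rw [← e1, ← e5] at h1
  rw [← e2, ← e6] at h2
  rw [← e1, ← e2, ← e3]
  norm_cast at *
  omega

/-- The affine dimension theorem: through a common rational point, the codimension of an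
intersection in affine space is at most the sum of the codimensions. -/
theorem MvPolynomial.exists_isPrime_sup_le_height_le {σ : Type*} [Finite σ]
    (ε : MvPolynomial σ K →ₐ[K] K) (p q : Ideal (MvPolynomial σ K)) [p.IsPrime] [q.IsPrime]
    (hp : p ≤ RingHom.ker ε) (hq : q ≤ RingHom.ker ε) :
    ∃ P : Ideal (MvPolynomial σ K), P.IsPrime ∧ p ⊔ q ≤ P ∧ P.height ≤ p.height + q.height := by
  obtain ⟨n, ⟨e⟩⟩ := Finite.exists_equiv_fin σ
  let φ := renameEquiv K e.symm
  obtain ⟨P, hP, hle, hht⟩ := exists_isPrime_sup_le_height_le_fin (ε.comp φ.toAlgHom)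
    (p.comap φ.toRingEquiv) (q.comap φ.toRingEquiv) (fun x hx => hp hx) (fun x hx => hq hx)
  rw [φ.toRingEquiv.height_comap, φ.toRingEquiv.height_comap] at hht
  refine ⟨P.comap φ.symm.toRingEquiv, inferInstance, ?_, ?_⟩
  · refine sup_le (fun x hx => ?_) (fun x hx => ?_)
    · refine hle (le_sup_left (a := p.comap φ.toRingEquiv) (b := q.comap φ.toRingEquiv) ?_)
      simpa [Ideal.mem_comap] using hx
    · refine hle (le_sup_right (a := p.comap φ.toRingEquiv) (b := q.comap φ.toRingEquiv) ?_)
      simpa [Ideal.mem_comap] using hx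
  · rw [φ.symm.toRingEquiv.height_comap]
    exact hht

end Diagonal

/-! ### Homogeneous ideals and subadditivity of height. -/

section Homogeneous

open MvPolynomial

variable {K σ : Type*} [Field K]

attribute [local instance] MvPolynomial.gradedAlgebra in
/-- The minimal primes of an ideal generated by homogeneous polynomials have no constant terms:
their zero sets are cones. -/
theorem MvPolynomial.le_ker_of_mem_minimalPrimes_span {s : Set (MvPolynomial σ K)}
    (hs : ∀ f ∈ s, ∃ d : ℕ, f.IsHomogeneous d) {p : Ideal (MvPolynomial σ K)}
    (hp : p ∈ (Ideal.span s).minimalPrimes) :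
    p ≤ RingHom.ker (aeval (fun _ => 0) : MvPolynomial σ K →ₐ[K] K) := by
  have hpp : p.IsPrime := hp.1.1
  have hI : (Ideal.span s).IsHomogeneous (homogeneousSubmodule σ K) :=
    Ideal.homogeneous_span _ _ fun f hf => hs f hf
  have hle : Ideal.span s ≤ (p.homogeneousCore (homogeneousSubmodule σ K)).toIdeal := by
    rw [← hI.toIdeal_homogeneousCore_eq_self]
    exact Ideal.homogeneousCore_mono _ hp.1.2
  -- The homogeneous core of a prime is prime; here it still contains the ideal, so minimality of
  -- `p` gives equality.
  have heq : (p.homogeneousCore (homogeneousSubmodule σ K)).toIdeal = p :=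
    le_antisymm (Ideal.toIdeal_homogeneousCore_le _ _)
      (hp.2 ⟨hpp.homogeneousCore, hle⟩ (Ideal.toIdeal_homogeneousCore_le _ _))
  have hph : p.IsHomogeneous (homogeneousSubmodule σ K) := by
    rw [← heq]; exact HomogeneousIdeal.isHomogeneous _
  intro f hf
  have h1 : C (coeff 0 f) ∈ p := by
    have := homogeneousComponent_mem_of_mem hph hf 0
    rwa [homogeneousComponent_zero] at this
  have h2 : coeff 0 f = 0 := by
    by_contra h
    exact hpp.ne_top (Ideal.eq_top_of_isUnit_mem _ h1 ((isUnit_iff_ne_zero.2 h).map C))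
  rw [RingHom.mem_ker]
  have : (aeval (fun _ => 0) : MvPolynomial σ K →ₐ[K] K) f = coeff 0 f := by
    rw [aeval_zero', constantCoeff_eq]; rfl
  rw [this, h2]

/-- Subadditivity of height for ideals generated by homogeneous polynomials. -/
theorem MvPolynomial.height_span_sup_span_le [Finite σ] {s t : Set (MvPolynomial σ K)}
    (hs : ∀ f ∈ s, ∃ d : ℕ, f.IsHomogeneous d) (ht : ∀ f ∈ t, ∃ d : ℕ, f.IsHomogeneous d) :
    (Ideal.span s ⊔ Ideal.span t).height ≤ (Ideal.span s).height + (Ideal.span t).height := by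
  have key : ∀ I : Ideal (MvPolynomial σ K), I.height ≠ ⊤ →
      ∃ p ∈ I.minimalPrimes, p.height = I.height := by
    intro I hI
    obtain ⟨n, hn⟩ := ENat.ne_top_iff_exists.1 hI
    obtain ⟨p, hp, hIp, hpn⟩ := Ideal.exists_isPrime_height_eq hn.symm
    exact ⟨p, Ideal.mem_minimalPrimes_of_height_le hIp (by rw [hpn, hn]), by rw [hpn, hn]⟩
  by_cases hs' : (Ideal.span s).height = ⊤
  · simp [hs']
  by_cases ht' : (Ideal.span t).height = ⊤
  · simp [ht']
  obtain ⟨p, hp, hpe⟩ := key _ hs'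
  obtain ⟨q, hq, hqe⟩ := key _ ht'
  have hpp : p.IsPrime := hp.1.1
  have hqp : q.IsPrime := hq.1.1
  -- The common rational point is the origin.
  obtain ⟨P, hP, hle, hht⟩ := exists_isPrime_sup_le_height_le _ p q
    (le_ker_of_mem_minimalPrimes_span hs hp) (le_ker_of_mem_minimalPrimes_span ht hq)
  rw [← hpe, ← hqe]
  exact (Ideal.height_mono ((sup_le_sup hp.1.2 hq.1.2).trans hle)).trans hht

end Homogeneous

noncomputable section

namespace Tripartite

/-! ### Polynomial functions and codimension in coordinates. -/

section PolyFun

variable {K V σ : Type*} [Field K] [AddCommGroup V] [Module K V]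

theorem range_aeval_coordinates [Finite σ] (c : V ≃ₗ[K] (σ → K)) :
    (MvPolynomial.aeval (fun s v => c v s) : MvPolynomial σ K →ₐ[K] (V → K)).range =
      polyFun K V := by
  classical
  have := Fintype.ofFinite σ
  rw [MvPolynomial.aeval_range]
  apply le_antisymm
  · refine Algebra.adjoin_mono ?_
    rintro _ ⟨s, rfl⟩
    exact ⟨(LinearMap.proj s).comp c.toLinearMap, rfl⟩
  · refine Algebra.adjoin_le ?_
    rintro _ ⟨φ, rfl⟩
    have h : (φ : V → K) = ∑ s, φ (c.symm (Pi.single s 1)) • fun v => c v s := by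
      funext v
      conv_lhs => rw [← c.symm_apply_apply v, pi_eq_sum_univ' (c v)]
      simp [map_sum, mul_comm]
    change (φ : V → K) ∈ Algebra.adjoin K (Set.range fun s v => c v s)
    rw [h]
    exact Subalgebra.sum_mem _ fun s _ =>
      Subalgebra.smul_mem _ (Algebra.subset_adjoin (Set.mem_range_self s)) _

theorem aeval_coordinates_apply (c : V ≃ₗ[K] (σ → K)) (f : MvPolynomial σ K) (v : V) :
    MvPolynomial.aeval (fun s v => c v s : σ → V → K) f v = MvPolynomial.eval (c v) f := by
  have h : ((Pi.evalAlgHom K (fun _ : V => K) v).comp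
      (MvPolynomial.aeval (fun s v => c v s : σ → V → K))) = MvPolynomial.aeval (c v) :=
    MvPolynomial.algHom_ext fun s => by simp
  exact DFunLike.congr_fun h f

/-- Linear coordinates identify the polynomial functions with a polynomial ring. -/
def polyFunEquiv [Finite σ] [Infinite K] (c : V ≃ₗ[K] (σ → K)) : MvPolynomial σ K ≃ₐ[K] polyFun K V :=
  (AlgEquiv.ofInjective (MvPolynomial.aeval (fun s v => c v s)) (by
    intro f g hfg
    refine MvPolynomial.funext fun x => ?_
    have := congrFun hfg (c.symm x)
    rwa [aeval_coordinates_apply, aeval_coordinates_apply, c.apply_symm_apply] at this)).trans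
  (Subalgebra.equivOfEq _ _ (range_aeval_coordinates c))

theorem polyFunEquiv_apply [Finite σ] [Infinite K] (c : V ≃ₗ[K] (σ → K)) (f : MvPolynomial σ K) (v : V) :
    (polyFunEquiv c f : V → K) v = MvPolynomial.eval (c v) f :=
  aeval_coordinates_apply c f v

/-- By the Nullstellensatz the vanishing ideal is the radical of `I`, which has the same minimal
primes. Any defining equations therefore compute the codimension. -/
theorem codim_zeroLocus [Finite σ] [IsAlgClosed K] (c : V ≃ₗ[K] (σ → K)) (I : Ideal (MvPolynomial σ K)) :
    codim K (c ⁻¹' MvPolynomial.zeroLocus K I) = I.height := by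
  have : Infinite K := IsAlgClosed.instInfinite
  have h : (idealOf K (c ⁻¹' MvPolynomial.zeroLocus K I)).comap (polyFunEquiv c).toRingEquiv =
      MvPolynomial.vanishingIdeal K (MvPolynomial.zeroLocus K I) := by
    ext f
    constructor
    · intro hf x hx
      have := hf (c.symm x) (by simpa using hx)
      rw [MvPolynomial.aeval_eq_eval, ← c.apply_symm_apply x]
      exact (polyFunEquiv_apply c f _).symm.trans this
    · intro hf v hv
      exact (polyFunEquiv_apply c f v).trans (hf (c v) hv)
  rw [codim, ← (polyFunEquiv c).toRingEquiv.height_comap, h,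
    MvPolynomial.vanishingIdeal_zeroLocus_eq_radical, Ideal.height_radical]

end PolyFun

/-! ### Geometric rank as the height of an ideal of bilinear forms. -/

section Tensors

variable {K A B C : Type*} [Field K]
  [AddCommGroup A] [Module K A] [AddCommGroup B] [Module K B] [AddCommGroup C] [Module K C]

theorem value_add (S T : A ⊗[K] (B ⊗[K] C)) (x : Module.Dual K A) (y : Module.Dual K B)
    (z : Module.Dual K C) : value (S + T) x y z = value S x y z + value T x y z := by
  simp [value]

variable {ι κ : Type*} [Fintype ι] [Fintype κ]

theorem value_eq_sum (a : Module.Basis ι K A) (b : Module.Basis κ K B) (T : A ⊗[K] (B ⊗[K] C))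
    (x : Module.Dual K A) (y : Module.Dual K B) (z : Module.Dual K C) :
    value T x y z = ∑ i, ∑ j, value T (a.coord i) (b.coord j) z * x (a i) * y (b j) := by
  conv_lhs => rw [← a.sum_dual_apply_smul_coord x, ← b.sum_dual_apply_smul_coord y]
  simp only [value, TensorProduct.sum_tmul, TensorProduct.tmul_sum, map_sum, LinearMap.sum_apply,
    ← TensorProduct.smul_tmul', TensorProduct.tmul_smul, map_smul, LinearMap.smul_apply,
    smul_eq_mul]
  rw [Finset.sum_comm]
  refine Finset.sum_congr rfl fun j _ => ?_
  rw [Finset.mul_sum]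
  exact Finset.sum_congr rfl fun i _ => by ring

variable (a : Module.Basis ι K A) (b : Module.Basis κ K B)

open MvPolynomial

/-- The bilinear form `T(·, ·, z)` as a polynomial in the coordinates of `A* × B*`. -/
def slicePoly (T : A ⊗[K] (B ⊗[K] C)) (z : Module.Dual K C) : MvPolynomial (ι ⊕ κ) K :=
  ∑ i, ∑ j, MvPolynomial.C (value T (a.coord i) (b.coord j) z) * X (Sum.inl i) * X (Sum.inr j)

/-- The ideal generated by the bilinear forms `T(·, ·, z)`. -/
def sliceIdeal (T : A ⊗[K] (B ⊗[K] C)) : Ideal (MvPolynomial (ι ⊕ κ) K) :=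
  Ideal.span (Set.range (slicePoly a b T))

/-- The coordinates `(x(aᵢ), y(bⱼ))` on `A* × B*`. -/
def coordinates [DecidableEq ι] [DecidableEq κ] :
    (Module.Dual K A × Module.Dual K B) ≃ₗ[K] (ι ⊕ κ → K) :=
  (a.dualBasis.equivFun.prodCongr b.dualBasis.equivFun).trans
    (LinearEquiv.sumArrowLequivProdArrow ι κ K K).symm

theorem coordinates_apply [DecidableEq ι] [DecidableEq κ]
    (v : Module.Dual K A × Module.Dual K B) :
    coordinates a b v = Sum.elim (fun i => v.1 (a i)) (fun j => v.2 (b j)) := by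
  funext s
  rcases s with i | j
  · simp [coordinates]
  · simp [coordinates]

theorem eval_slicePoly (T : A ⊗[K] (B ⊗[K] C)) (z : Module.Dual K C) (x : Module.Dual K A)
    (y : Module.Dual K B) :
    eval (Sum.elim (fun i => x (a i)) (fun j => y (b j))) (slicePoly a b T z) =
      value T x y z := by
  rw [value_eq_sum a b]
  simp [slicePoly]

theorem slicePoly_isHomogeneous (T : A ⊗[K] (B ⊗[K] C)) (z : Module.Dual K C) :
    (slicePoly a b T z).IsHomogeneous 2 :=
  IsHomogeneous.sum _ _ _ fun _ _ => IsHomogeneous.sum _ _ _ fun _ _ =>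
    ((isHomogeneous_C _ _).mul (isHomogeneous_X _ _)).mul (isHomogeneous_X _ _)

theorem slicePoly_add (S T : A ⊗[K] (B ⊗[K] C)) (z : Module.Dual K C) :
    slicePoly a b (S + T) z = slicePoly a b S z + slicePoly a b T z := by
  simp only [slicePoly, value_add, map_add, add_mul, Finset.sum_add_distrib]

theorem geometricRank_eq_height [IsAlgClosed K] (T : A ⊗[K] (B ⊗[K] C)) :
    geometricRank T = (sliceIdeal a b T).height := by
  classical
  rw [← codim_zeroLocus (coordinates a b), geometricRank]
  congr 1
  ext v
  simp only [Set.mem_ofPred_eq, Set.mem_preimage, sliceIdeal, zeroLocus_span, Set.forall_mem_range,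
    aeval_eq_eval, coordinates_apply]
  refine forall_congr' fun z => ?_
  rw [← eval_slicePoly a b]

/-- The forms of `S + T` lie in the sum of the two slice ideals, and both are generated by quadrics.
-/
theorem geometricRank_add_le [IsAlgClosed K] [FiniteDimensional K A] [FiniteDimensional K B]
    (S T : A ⊗[K] (B ⊗[K] C)) : geometricRank (S + T) ≤ geometricRank S + geometricRank T := by
  let a := Module.finBasis K A
  let b := Module.finBasis K B
  rw [geometricRank_eq_height a b, geometricRank_eq_height a b, geometricRank_eq_height a b]
  refine le_trans (Ideal.height_mono ?_) (height_span_sup_span_le (s := Set.range (slicePoly a b S))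
    (t := Set.range (slicePoly a b T)) ?_ ?_)
  · refine Ideal.span_le.2 ?_
    rintro _ ⟨z, rfl⟩
    rw [slicePoly_add]
    exact Ideal.add_mem _ (Ideal.mem_sup_left (Ideal.subset_span ⟨z, rfl⟩))
      (Ideal.mem_sup_right (Ideal.subset_span ⟨z, rfl⟩))
  · rintro _ ⟨z, rfl⟩
    exact ⟨2, slicePoly_isHomogeneous a b S z⟩
  · rintro _ ⟨z, rfl⟩
    exact ⟨2, slicePoly_isHomogeneous a b T z⟩

end Tensors

end Tripartite

end

noncomputable section

namespace Tripartite

/-! ### Flattenings and subadditivity of slice rank. -/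

section Flattenings

variable {K A B C : Type*} [Field K]
  [AddCommGroup A] [Module K A] [AddCommGroup B] [Module K B] [AddCommGroup C] [Module K C]

theorem value_eq_flatA (T : A ⊗[K] (B ⊗[K] C)) (x : Module.Dual K A) (y : Module.Dual K B)
    (z : Module.Dual K C) :
    value T x y z = TensorProduct.dualDistrib K B C (y ⊗ₜ z) (flatA T x) := by
  induction T using TensorProduct.induction_on with
  | zero => simp [value, flatA]
  | add S T hS hT => rw [value_add, hS, hT]; simp [flatA]
  | tmul a t => simp [value, flatA]

theorem value_eq_flatB (T : A ⊗[K] (B ⊗[K] C)) (x : Module.Dual K A) (y : Module.Dual K B)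
    (z : Module.Dual K C) :
    value T x y z = TensorProduct.dualDistrib K A C (x ⊗ₜ z) (flatB T y) := by
  induction T using TensorProduct.induction_on with
  | zero => simp [value, flatB]
  | add S T hS hT => rw [value_add, hS, hT]; simp [flatB]
  | tmul a t =>
    induction t using TensorProduct.induction_on with
    | zero => simp [value, flatB]
    | add s t hs ht => rw [TensorProduct.tmul_add, value_add, hs, ht]; simp [flatB]
    | tmul b c => simp [value, flatB]; ring

theorem value_eq_flatC (T : A ⊗[K] (B ⊗[K] C)) (x : Module.Dual K A) (y : Module.Dual K B)
    (z : Module.Dual K C) :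
    value T x y z = TensorProduct.dualDistrib K A B (x ⊗ₜ y) (flatC T z) := by
  induction T using TensorProduct.induction_on with
  | zero => simp [value, flatC]
  | add S T hS hT => rw [value_add, hS, hT]; simp [flatC]
  | tmul a t =>
    induction t using TensorProduct.induction_on with
    | zero => simp [value, flatC]
    | add s t hs ht => rw [TensorProduct.tmul_add, value_add, hs, ht]; simp [flatC]
    | tmul b c => simp [value, flatC]; ring

theorem flatA_add (S T : A ⊗[K] (B ⊗[K] C)) : flatA (S + T) = flatA S + flatA T := by
  ext; simp [flatA]

theorem flatB_add (S T : A ⊗[K] (B ⊗[K] C)) : flatB (S + T) = flatB S + flatB T := by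
  ext; simp [flatB]

theorem flatC_add (S T : A ⊗[K] (B ⊗[K] C)) : flatC (S + T) = flatC S + flatC T := by
  ext; simp [flatC]

theorem mlA_zero : mlA (0 : A ⊗[K] (B ⊗[K] C)) = 0 := by
  have : flatA (0 : A ⊗[K] (B ⊗[K] C)) = 0 := by ext; simp [flatA]
  rw [mlA, this, LinearMap.range_zero, finrank_bot]

theorem mlB_zero : mlB (0 : A ⊗[K] (B ⊗[K] C)) = 0 := by
  have : flatB (0 : A ⊗[K] (B ⊗[K] C)) = 0 := by ext; simp [flatB]
  rw [mlB, this, LinearMap.range_zero, finrank_bot]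

theorem mlC_zero : mlC (0 : A ⊗[K] (B ⊗[K] C)) = 0 := by
  have : flatC (0 : A ⊗[K] (B ⊗[K] C)) = 0 := by ext; simp [flatC]
  rw [mlC, this, LinearMap.range_zero, finrank_bot]

theorem sliceRank_le (T₁ T₂ T₃ : A ⊗[K] (B ⊗[K] C)) :
    sliceRank (T₁ + T₂ + T₃) ≤ mlA T₁ + mlB T₂ + mlC T₃ :=
  Nat.sInf_le ⟨T₁, T₂, T₃, rfl, rfl⟩

theorem exists_sliceRank_eq (T : A ⊗[K] (B ⊗[K] C)) :
    ∃ T₁ T₂ T₃ : A ⊗[K] (B ⊗[K] C), T = T₁ + T₂ + T₃ ∧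
      sliceRank T = mlA T₁ + mlB T₂ + mlC T₃ :=
  Nat.sInf_mem (s := {n | ∃ T₁ T₂ T₃ : A ⊗[K] (B ⊗[K] C), T = T₁ + T₂ + T₃ ∧
    n = mlA T₁ + mlB T₂ + mlC T₃}) ⟨_, T, 0, 0, by simp, rfl⟩

theorem sliceRank_le_mlA (T : A ⊗[K] (B ⊗[K] C)) : sliceRank T ≤ mlA T := by
  simpa [mlB_zero, mlC_zero] using sliceRank_le T 0 0

theorem sliceRank_le_mlB (T : A ⊗[K] (B ⊗[K] C)) : sliceRank T ≤ mlB T := by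
  simpa [mlA_zero, mlC_zero] using sliceRank_le 0 T 0

theorem sliceRank_le_mlC (T : A ⊗[K] (B ⊗[K] C)) : sliceRank T ≤ mlC T := by
  simpa [mlA_zero, mlB_zero] using sliceRank_le 0 0 T

theorem finrank_range_add_le {M N : Type*} [AddCommGroup M] [Module K M] [AddCommGroup N]
    [Module K N] [FiniteDimensional K N] (f g : M →ₗ[K] N) :
    Module.finrank K (LinearMap.range (f + g)) ≤
      Module.finrank K (LinearMap.range f) + Module.finrank K (LinearMap.range g) :=
  (Submodule.finrank_mono (LinearMap.range_add_le f g)).trans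
    (Submodule.finrank_add_le_finrank_add_finrank _ _)

variable [FiniteDimensional K A] [FiniteDimensional K B] [FiniteDimensional K C]

theorem sliceRank_add_le (S T : A ⊗[K] (B ⊗[K] C)) :
    sliceRank (S + T) ≤ sliceRank S + sliceRank T := by
  obtain ⟨S₁, S₂, S₃, hS, hS'⟩ := exists_sliceRank_eq S
  obtain ⟨T₁, T₂, T₃, hT, hT'⟩ := exists_sliceRank_eq T
  have h : S + T = (S₁ + T₁) + (S₂ + T₂) + (S₃ + T₃) := by rw [hS, hT]; abel
  rw [hS', hT', h]
  refine (sliceRank_le _ _ _).trans ?_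
  have hA : mlA (S₁ + T₁) ≤ mlA S₁ + mlA T₁ := by
    rw [mlA, flatA_add]; exact finrank_range_add_le _ _
  have hB : mlB (S₂ + T₂) ≤ mlB S₂ + mlB T₂ := by
    rw [mlB, flatB_add]; exact finrank_range_add_le _ _
  have hC : mlC (S₃ + T₃) ≤ mlC S₃ + mlC T₃ := by
    rw [mlC, flatC_add]; exact finrank_range_add_le _ _
  omega

end Flattenings

/-! ### Geometric rank is at most slice rank. -/

section GeometricLeSlice

variable {K A B C : Type*} [Field K]
  [AddCommGroup A] [Module K A] [AddCommGroup B] [Module K B] [AddCommGroup C] [Module K C]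

theorem exists_eq_sum_smul {M N : Type*} [AddCommGroup M] [Module K M] [AddCommGroup N]
    [Module K N] [FiniteDimensional K M] (g : M →ₗ[K] N) :
    ∃ (l : Fin (Module.finrank K (LinearMap.range g)) → Module.Dual K M)
      (e : Fin (Module.finrank K (LinearMap.range g)) → N), ∀ x, g x = ∑ k, l k x • e k := by
  let β := Module.finBasis K (LinearMap.range g)
  refine ⟨fun k => (β.coord k).comp g.rangeRestrict, fun k => (β k : N), fun x => ?_⟩
  have h := congrArg (Subtype.val) (β.sum_repr (g.rangeRestrict x))
  rw [Submodule.coe_sum] at h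
  exact h.symm

open MvPolynomial

variable [IsAlgClosed K] {ι κ : Type*} [Fintype ι] [Fintype κ]
  (a : Module.Basis ι K A) (b : Module.Basis κ K B)

/-- Krull's height theorem. Vanishing constant terms keep the ideal of the `f k` proper; the unit
ideal has height `⊤`. -/
theorem geometricRank_le_of_slicePoly_mem {r : ℕ} (T : A ⊗[K] (B ⊗[K] C))
    (f : Fin r → MvPolynomial (ι ⊕ κ) K) (hf : ∀ k, constantCoeff (f k) = 0)
    (h : ∀ z, slicePoly a b T z ∈ Ideal.span (Set.range f)) : geometricRank T ≤ r := by
  rw [geometricRank_eq_height a b]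
  have hle : Ideal.span (Set.range f) ≤ RingHom.ker (constantCoeff (σ := ι ⊕ κ) (R := K)) := by
    rw [Ideal.span_le]
    rintro _ ⟨k, rfl⟩
    exact hf k
  have hne : Ideal.span (Set.range f) ≠ ⊤ := fun htop =>
    RingHom.ker_ne_top (constantCoeff (σ := ι ⊕ κ) (R := K)) (top_le_iff.1 (htop ▸ hle))
  refine (Ideal.height_mono (J := Ideal.span (Set.range f)) ?_).trans
    ((Ideal.height_le_spanFinrank _ hne).trans ?_)
  · rw [sliceIdeal, Ideal.span_le]
    rintro _ ⟨z, rfl⟩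
    exact h z
  · refine (Submodule.spanFinrank_span_le_encard _).trans ?_
    rw [← Set.image_univ]
    refine (Set.encard_image_le _ _).trans ?_
    simp [Set.encard_univ]

variable [FiniteDimensional K A] [FiniteDimensional K B]

/-- A rank factorization of the flattening puts every slice in the ideal of `mlA T` linear forms in
`x`. For `mlB` the generators are linear forms in `y`, for `mlC` bilinear forms. -/
theorem geometricRank_le_mlA (T : A ⊗[K] (B ⊗[K] C)) : geometricRank T ≤ mlA T := by
  let a := Module.finBasis K A
  let b := Module.finBasis K B
  obtain ⟨l, e, h⟩ := exists_eq_sum_smul (flatA T)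
  refine geometricRank_le_of_slicePoly_mem a b T
    (fun k => ∑ i, MvPolynomial.C (l k (a.coord i)) * X (Sum.inl i)) (fun k => by simp) fun z => ?_
  have heq : slicePoly a b T z = ∑ k, (∑ i, MvPolynomial.C (l k (a.coord i)) * X (Sum.inl i)) *
      ∑ j, MvPolynomial.C (TensorProduct.dualDistrib K B C (b.coord j ⊗ₜ z) (e k)) *
        X (Sum.inr j) := by
    simp_rw [Finset.sum_mul_sum, slicePoly, value_eq_flatA, h]
    rw [Finset.sum_comm (s := Finset.univ (α := Fin (Module.finrank K (LinearMap.range _))))]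
    refine Finset.sum_congr rfl fun i _ => ?_
    rw [Finset.sum_comm]
    refine Finset.sum_congr rfl fun j _ => ?_
    simp only [map_sum, map_smul, smul_eq_mul, map_mul, Finset.sum_mul]
    exact Finset.sum_congr rfl fun k _ => by ring
  rw [heq]
  exact Ideal.sum_mem _ fun k _ => Ideal.mul_mem_right _ _ (Ideal.subset_span ⟨k, rfl⟩)

theorem geometricRank_le_mlB (T : A ⊗[K] (B ⊗[K] C)) : geometricRank T ≤ mlB T := by
  let a := Module.finBasis K A
  let b := Module.finBasis K B
  obtain ⟨l, e, h⟩ := exists_eq_sum_smul (flatB T)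
  refine geometricRank_le_of_slicePoly_mem a b T
    (fun k => ∑ j, MvPolynomial.C (l k (b.coord j)) * X (Sum.inr j)) (fun k => by simp) fun z => ?_
  have heq : slicePoly a b T z = ∑ k,
      (∑ i, MvPolynomial.C (TensorProduct.dualDistrib K A C (a.coord i ⊗ₜ z) (e k)) *
        X (Sum.inl i)) * ∑ j, MvPolynomial.C (l k (b.coord j)) * X (Sum.inr j) := by
    simp_rw [Finset.sum_mul_sum, slicePoly, value_eq_flatB, h]
    rw [Finset.sum_comm (s := Finset.univ (α := Fin (Module.finrank K (LinearMap.range _))))]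
    refine Finset.sum_congr rfl fun i _ => ?_
    rw [Finset.sum_comm]
    refine Finset.sum_congr rfl fun j _ => ?_
    simp only [map_sum, map_smul, smul_eq_mul, map_mul, Finset.sum_mul]
    exact Finset.sum_congr rfl fun k _ => by ring
  rw [heq]
  exact Ideal.sum_mem _ fun k _ => Ideal.mul_mem_left _ _ (Ideal.subset_span ⟨k, rfl⟩)

theorem geometricRank_le_mlC [FiniteDimensional K C] (T : A ⊗[K] (B ⊗[K] C)) :
    geometricRank T ≤ mlC T := by
  let a := Module.finBasis K A
  let b := Module.finBasis K B
  obtain ⟨l, e, h⟩ := exists_eq_sum_smul (flatC T)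
  refine geometricRank_le_of_slicePoly_mem a b T
    (fun k => ∑ i, ∑ j, MvPolynomial.C (TensorProduct.dualDistrib K A B
      (a.coord i ⊗ₜ b.coord j) (e k)) * X (Sum.inl i) * X (Sum.inr j)) (fun k => by simp)
    fun z => ?_
  have heq : slicePoly a b T z = ∑ k, MvPolynomial.C (l k z) *
      ∑ i, ∑ j, MvPolynomial.C (TensorProduct.dualDistrib K A B
        (a.coord i ⊗ₜ b.coord j) (e k)) * X (Sum.inl i) * X (Sum.inr j) := by
    simp_rw [Finset.mul_sum, slicePoly, value_eq_flatC, h]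
    rw [Finset.sum_comm (s := Finset.univ (α := Fin (Module.finrank K (LinearMap.range _))))]
    refine Finset.sum_congr rfl fun i _ => ?_
    rw [Finset.sum_comm]
    refine Finset.sum_congr rfl fun j _ => ?_
    simp only [map_sum, map_smul, smul_eq_mul, map_mul, Finset.sum_mul]
    exact Finset.sum_congr rfl fun k _ => by ring
  rw [heq]
  exact Ideal.sum_mem _ fun k _ => Ideal.mul_mem_left _ _ (Ideal.subset_span ⟨k, rfl⟩)

theorem geometricRank_le_sliceRank [FiniteDimensional K C] (T : A ⊗[K] (B ⊗[K] C)) :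
    geometricRank T ≤ sliceRank T := by
  obtain ⟨T₁, T₂, T₃, hT, h⟩ := exists_sliceRank_eq T
  rw [h]
  push_cast
  calc geometricRank T ≤ geometricRank T₁ + geometricRank T₂ + geometricRank T₃ := by
        rw [hT]
        exact (geometricRank_add_le _ _).trans (by gcongr; exact geometricRank_add_le _ _)
    _ ≤ _ := by
        gcongr
        · exact geometricRank_le_mlA T₁
        · exact geometricRank_le_mlB T₂
        · exact geometricRank_le_mlC T₃

end GeometricLeSlice

end Tripartite

end

noncomputable section

namespace Tripartite

/-! ### Weighted degrees via dilation. -/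

section Dilate

open MvPolynomial

variable {K σ : Type*} [Field K]

/-- The substitution `Xₛ ↦ t ^ w(s) Xₛ` with a new variable `t`. -/
def dilate (w : σ → ℕ) : MvPolynomial σ K →ₐ[K] Polynomial (MvPolynomial σ K) :=
  aeval fun s => Polynomial.C (X s) * Polynomial.X ^ w s

theorem eval_eval_dilate (w : σ → ℕ) (x : σ → K) (t : K) (f : MvPolynomial σ K) :
    eval x (Polynomial.eval (MvPolynomial.C t) (dilate w f)) = eval (fun s => x s * t ^ w s) f := by
  have h : ((aeval x).toRingHom.comp ((Polynomial.evalRingHom (MvPolynomial.C t)).comp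
      (dilate w).toRingHom)) = (aeval fun s => x s * t ^ w s : MvPolynomial σ K →ₐ[K] K).toRingHom := by
    refine MvPolynomial.ringHom_ext (fun r => ?_) fun s => ?_
    · simp [dilate, Polynomial.algebraMap_apply]
    · simp [dilate]
  have := DFunLike.congr_fun h f
  simpa [aeval_eq_eval] using this

/-- A polynomial of weighted degree zero does not see the variables of positive weight. -/
theorem eval_eq_of_natDegree_dilate_eq_zero {w : σ → ℕ} {f : MvPolynomial σ K}
    (hf : (dilate w f).natDegree = 0) (x : σ → K) :
    eval x f = eval (fun s => x s * 0 ^ w s) f := by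
  -- Constancy in `t` lets the values at `t = 1` and `t = 0` be compared; `0 ^ 0 = 1` preserves the
  -- variables of weight zero.
  have h1 := eval_eval_dilate w x 1 f
  have h0 := eval_eval_dilate w x 0 f
  rw [Polynomial.eq_C_of_natDegree_eq_zero hf, Polynomial.eval_C] at h0 h1
  rw [← h0, h1]
  simp

/-- Degree in `t` is additive over a domain, so a form of weight one has one factor of weight one
and one of weight zero. -/
theorem natDegree_dilate_add {w : σ → ℕ} {f g m : MvPolynomial σ K} (hm : m ≠ 0) (h : m = f * g)
    (hw : dilate w m = Polynomial.C m * Polynomial.X) :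
    (dilate w f).natDegree + (dilate w g).natDegree = 1 := by
  have hne : dilate w f * dilate w g ≠ 0 := by
    rw [← map_mul, ← h, hw]
    exact mul_ne_zero (by simpa using hm) Polynomial.X_ne_zero
  rw [← Polynomial.natDegree_mul (left_ne_zero_of_mul hne) (right_ne_zero_of_mul hne), ← map_mul,
    ← h, hw, Polynomial.natDegree_C_mul_X _ hm]

end Dilate

/-! ### Tensors of geometric rank one. -/

section RankOne

variable {K A B C : Type*} [Field K]
  [AddCommGroup A] [Module K A] [AddCommGroup B] [Module K B] [AddCommGroup C] [Module K C]

open MvPolynomial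

section

variable {ι κ : Type*} [Fintype ι] [Fintype κ] (a : Module.Basis ι K A) (b : Module.Basis κ K B)

theorem dilate_left_slicePoly (T : A ⊗[K] (B ⊗[K] C)) (z : Module.Dual K C) :
    dilate (Sum.elim 1 0) (slicePoly a b T z) =
      Polynomial.C (slicePoly a b T z) * Polynomial.X := by
  simp only [slicePoly, map_sum, map_mul, Finset.sum_mul]
  refine Finset.sum_congr rfl fun i _ => Finset.sum_congr rfl fun j _ => ?_
  simp [dilate, Polynomial.algebraMap_apply]
  ring

theorem dilate_right_slicePoly (T : A ⊗[K] (B ⊗[K] C)) (z : Module.Dual K C) :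
    dilate (Sum.elim 0 1) (slicePoly a b T z) =
      Polynomial.C (slicePoly a b T z) * Polynomial.X := by
  simp only [slicePoly, map_sum, map_mul, Finset.sum_mul]
  refine Finset.sum_congr rfl fun i _ => Finset.sum_congr rfl fun j _ => ?_
  simp [dilate, Polynomial.algebraMap_apply]
  ring

/-- A height-one prime in a factorial ring is principal; its generator divides everything in the
slice ideal. -/
theorem exists_prime_dvd_slicePoly [IsAlgClosed K] {T : A ⊗[K] (B ⊗[K] C)}
    (hT : geometricRank T = 1) :
    ∃ f : MvPolynomial (ι ⊕ κ) K, Prime f ∧ ∀ z, f ∣ slicePoly a b T z := by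
  rw [geometricRank_eq_height a b] at hT
  obtain ⟨p, hp, hle, hp1⟩ := Ideal.exists_isPrime_height_eq (n := 1) (by simpa using hT)
  have hp1' : p.height = 1 := by simpa using hp1
  obtain ⟨f, hfp, hf⟩ := Ideal.IsPrime.exists_mem_prime_of_ne_bot hp
    (Ideal.ne_bot_of_height_eq_one hp1')
  refine ⟨f, hf, fun z => ?_⟩
  rw [← Ideal.mem_span_singleton, ← Ideal.eq_span_singleton_of_height_eq_one hp1' hfp hf]
  exact hle (Ideal.subset_span ⟨z, rfl⟩)

end

theorem exists_value_ne_zero [IsAlgClosed K] [FiniteDimensional K A] [FiniteDimensional K B]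
    {T : A ⊗[K] (B ⊗[K] C)} (hT : geometricRank T ≠ 0) : ∃ x y z, value T x y z ≠ 0 := by
  by_contra! h
  apply hT
  rw [geometricRank_eq_height (Module.finBasis K A) (Module.finBasis K B),
    Ideal.height_eq_zero_iff_eq_bot, sliceIdeal, Ideal.span_eq_bot]
  rintro _ ⟨z, rfl⟩
  simp [slicePoly, h]

theorem eq_of_dualDistrib_eq {M N : Type*} [AddCommGroup M] [Module K M] [AddCommGroup N]
    [Module K N] [FiniteDimensional K M] [FiniteDimensional K N] {s t : M ⊗[K] N}
    (h : ∀ y z, TensorProduct.dualDistrib K M N (y ⊗ₜ z) s =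
      TensorProduct.dualDistrib K M N (y ⊗ₜ z) t) : s = t := by
  let β := (Module.finBasis K M).tensorProduct (Module.finBasis K N)
  have key : ∀ (i) (j) (u : M ⊗[K] N), β.repr u (i, j) = TensorProduct.dualDistrib K M N
      ((Module.finBasis K M).coord i ⊗ₜ (Module.finBasis K N).coord j) u := by
    intro i j u
    induction u using TensorProduct.induction_on with
    | zero => simp
    | add u v hu hv => rw [map_add, map_add, Finsupp.add_apply, hu, hv]
    | tmul m n => simp [β, mul_comm]
  refine β.ext_elem fun ⟨i, j⟩ => ?_
  rw [key, key]
  exact h _ _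

theorem finrank_range_le_one {M N : Type*} [AddCommGroup M] [Module K M] [AddCommGroup N]
    [Module K N] (g : M →ₗ[K] N) (x₀ : M) (c : M → K) (h : ∀ x, g x = c x • g x₀) :
    Module.finrank K (LinearMap.range g) ≤ 1 := by
  refine finrank_le_one (⟨g x₀, x₀, rfl⟩ : LinearMap.range g) ?_
  rintro ⟨_, x, rfl⟩
  exact ⟨c x, Subtype.ext (h x).symm⟩

theorem mlA_le_one [FiniteDimensional K B] [FiniteDimensional K C] {T : A ⊗[K] (B ⊗[K] C)}
    (x₀ : Module.Dual K A) (c : Module.Dual K A → K)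
    (h : ∀ x y z, value T x y z = c x * value T x₀ y z) : mlA T ≤ 1 :=
  finrank_range_le_one _ x₀ c fun x => eq_of_dualDistrib_eq fun y z => by
    rw [← value_eq_flatA, h, map_smul, ← value_eq_flatA, smul_eq_mul]

theorem mlB_le_one [FiniteDimensional K A] [FiniteDimensional K C] {T : A ⊗[K] (B ⊗[K] C)}
    (y₀ : Module.Dual K B) (c : Module.Dual K B → K)
    (h : ∀ x y z, value T x y z = c y * value T x y₀ z) : mlB T ≤ 1 :=
  finrank_range_le_one _ y₀ c fun y => eq_of_dualDistrib_eq fun x z => by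
    rw [← value_eq_flatB, h, map_smul, ← value_eq_flatB, smul_eq_mul]

theorem mlC_le_one [FiniteDimensional K A] [FiniteDimensional K B] {T : A ⊗[K] (B ⊗[K] C)}
    (z₀ : Module.Dual K C) (c : Module.Dual K C → K)
    (h : ∀ x y z, value T x y z = c z * value T x y z₀) : mlC T ≤ 1 :=
  finrank_range_le_one _ z₀ c fun z => eq_of_dualDistrib_eq fun x y => by
    rw [← value_eq_flatC, h, map_smul, ← value_eq_flatC, smul_eq_mul]

/-- Tensors of geometric rank one have slice rank at most one: the bilinear forms `T(·, ·, z)` have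
a common irreducible factor, which is of bidegree `(1, 0)`, `(0, 1)` or `(1, 1)`. -/
theorem sliceRank_le_one_of_geometricRank_eq_one [IsAlgClosed K] [FiniteDimensional K A]
    [FiniteDimensional K B] [FiniteDimensional K C] {T : A ⊗[K] (B ⊗[K] C)}
    (hT : geometricRank T = 1) : sliceRank T ≤ 1 := by
  have hinf : Infinite K := IsAlgClosed.instInfinite
  let a := Module.finBasis K A
  let b := Module.finBasis K B
  obtain ⟨f, hf, hdvd⟩ := exists_prime_dvd_slicePoly a b hT
  choose g hg using hdvd
  obtain ⟨x₀, y₀, z₀, h₀⟩ := exists_value_ne_zero (T := T) (by simp [hT])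
  let pt : Module.Dual K A → Module.Dual K B → _ → K :=
    fun x y => Sum.elim (fun i => x (a i)) (fun j => y (b j))
  have hval : ∀ x y z, value T x y z = eval (pt x y) f * eval (pt x y) (g z) := by
    intro x y z
    rw [← map_mul, ← hg, eval_slicePoly]
  have hleft : ∀ p, (dilate (Sum.elim 1 0) p).natDegree = 0 →
      ∀ x y, eval (pt x y) p = eval (pt 0 y) p := by
    intro p hp x y
    rw [eval_eq_of_natDegree_dilate_eq_zero hp (pt x y)]
    congr 1
    congr 1
    funext s
    rcases s with i | j <;> simp [pt]
  have hright : ∀ p, (dilate (Sum.elim 0 1) p).natDegree = 0 →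
      ∀ x y, eval (pt x y) p = eval (pt x 0) p := by
    intro p hp x y
    rw [eval_eq_of_natDegree_dilate_eq_zero hp (pt x y)]
    congr 1
    congr 1
    funext s
    rcases s with i | j <;> simp [pt]
  have hz₀ : slicePoly a b T z₀ ≠ 0 := fun h => h₀ (by rw [← eval_slicePoly a b, h, map_zero])
  -- For each of the two gradings the weight sits either in `f` or, for every `z` at once, in the
  -- cofactors `g z`.
  have hgz : ∀ w, (∀ z, dilate w (slicePoly a b T z) =
      Polynomial.C (slicePoly a b T z) * Polynomial.X) → (dilate w f).natDegree = 0 ∨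
      ∀ z, (dilate w (g z)).natDegree = 0 := by
    intro w hw
    rw [or_iff_not_imp_left]
    intro hne z
    by_cases hz : slicePoly a b T z = 0
    · have : g z = 0 := by
        have := hg z
        rw [hz] at this
        exact (mul_eq_zero.1 this.symm).resolve_left hf.ne_zero
      simp [this]
    · have := natDegree_dilate_add hz (hg z) (hw z)
      omega
  have hf0 : eval (pt x₀ y₀) f ≠ 0 := fun h => h₀ (by rw [hval, h, zero_mul])
  have hg0 : eval (pt x₀ y₀) (g z₀) ≠ 0 := fun h => h₀ (by rw [hval, h, mul_zero])
  -- Four cases: `f` is constant, which is absurd for a prime; `T = f(y) g_z(x)`; `T = f(x) g_z(y)`;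
  -- or `T = g_z f(x, y)` with `g_z` a scalar. The last three bound `mlB`, `mlA` and `mlC`.
  rcases hgz _ (dilate_left_slicePoly a b T) with hl | hl <;>
    rcases hgz _ (dilate_right_slicePoly a b T) with hr | hr
  · exfalso
    have hconst : f = MvPolynomial.C (eval (pt 0 0) f) := by
      refine MvPolynomial.funext fun u => ?_
      let v := (coordinates a b).symm u
      have hv : pt v.1 v.2 = u := by
        rw [← (coordinates a b).apply_symm_apply u, coordinates_apply]
      rw [eval_C, ← hv, hleft f hl, hright f hr]
    refine hf.not_isUnit ?_
    rw [hconst]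
    refine (isUnit_iff_ne_zero.2 fun h => hf.ne_zero ?_).map MvPolynomial.C
    rw [hconst, h, map_zero]
  · refine (sliceRank_le_mlB T).trans (mlB_le_one y₀
      (fun y => eval (pt 0 y) f / eval (pt x₀ y₀) f) fun x y z => ?_)
    rw [hval, hval, hleft f hl x y, hright _ (hr z) x y, hright _ (hr z) x y₀,
      hleft f hl x y₀, ← hleft f hl x₀ y₀]
    field_simp
  · refine (sliceRank_le_mlA T).trans (mlA_le_one x₀
      (fun x => eval (pt x 0) f / eval (pt x₀ y₀) f) fun x y z => ?_)
    rw [hval, hval, hright f hr x y, hleft _ (hl z) x y, hleft _ (hl z) x₀ y,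
      hright f hr x₀ y, ← hright f hr x₀ y₀]
    field_simp
  · have hc : ∀ x y z, eval (pt x y) (g z) = eval (pt x₀ y₀) (g z) := fun x y z => by
      rw [hleft _ (hl z) x y, hright _ (hr z) 0 y, hleft _ (hl z) x₀ y₀, hright _ (hr z) 0 y₀]
    refine (sliceRank_le_mlC T).trans (mlC_le_one z₀
      (fun z => eval (pt x₀ y₀) (g z) / eval (pt x₀ y₀) (g z₀)) fun x y z => ?_)
    rw [hval, hval, hc x y z, hc x y z₀]
    field_simp

end RankOne

/-! ### Peeling off summands of geometric rank one. -/

section Decomposition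

variable {K A B C : Type*} [Field K] [IsAlgClosed K]
  [AddCommGroup A] [Module K A] [AddCommGroup B] [Module K B] [AddCommGroup C] [Module K C]
  [FiniteDimensional K A] [FiniteDimensional K B] [FiniteDimensional K C]

/-- Only an upper bound on `SR(Tc)` is carried through the induction; equality follows once, at the
end, from subadditivity of geometric rank. -/
theorem exists_isPrimitive_add (n : ℕ) (T : A ⊗[K] (B ⊗[K] C)) (hT : geometricRank T = n) :
    ∃ (Tp Tc : A ⊗[K] (B ⊗[K] C)) (r k : ℕ), IsPrimitiveOfRank Tp r ∧ T = Tp + Tc ∧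
      r + k = n ∧ sliceRank Tc ≤ k := by
  induction n generalizing T with
  | zero =>
    refine ⟨T, 0, 0, 0, ⟨hT, ?_⟩, by simp, rfl, ?_⟩
    -- Rank zero is primitive because `geometricRank X + 1 = 0` is impossible.
    · rintro ⟨X, Y, -, h, -⟩
      simp at h
    · simpa [mlA_zero] using sliceRank_le_mlA (0 : A ⊗[K] (B ⊗[K] C))
  | succ n ih =>
    by_cases hprim : ∃ X Y : A ⊗[K] (B ⊗[K] C), T = X + Y ∧
        geometricRank X + 1 = (n + 1 : ℕ) ∧ geometricRank Y = 1
    · obtain ⟨X, Y, hXY, hX, hY⟩ := hprim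
      have hX' : geometricRank X = n := by
        obtain ⟨m, hm⟩ := ENat.ne_top_iff_exists.1
          (lt_of_le_of_lt (hX ▸ le_self_add) (ENat.natCast_lt_top (n + 1))).ne
        rw [← hm] at hX ⊢
        norm_cast at hX ⊢
        omega
      obtain ⟨Tp, Tc, r, k, hTp, hadd, hrk, hsr⟩ := ih X hX'
      refine ⟨Tp, Tc + Y, r, k + 1, hTp, by rw [hXY, hadd, add_assoc], by omega, ?_⟩
      have h1 := sliceRank_add_le Tc Y
      have h2 := sliceRank_le_one_of_geometricRank_eq_one hY
      omega
    · refine ⟨T, 0, n + 1, 0, ⟨hT, hprim⟩, by simp, rfl, ?_⟩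
      simpa [mlA_zero] using sliceRank_le_mlA (0 : A ⊗[K] (B ⊗[K] C))

end Decomposition

end Tripartite

end

theorem lemma2p3 {K : Type*} [Field K] [IsAlgClosed K] [CharZero K]
    {A B C : Type*} [AddCommGroup A] [Module K A] [FiniteDimensional K A]
    [AddCommGroup B] [Module K B] [FiniteDimensional K B]
    [AddCommGroup C] [Module K C] [FiniteDimensional K C]
    (T : A ⊗[K] (B ⊗[K] C))
    (hT : Tripartite.geometricRank T < (Tripartite.sliceRank T : ℕ∞)) :
    ∃ Tp Tc : A ⊗[K] (B ⊗[K] C),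
      Tripartite.IsPrimitive Tp ∧ Tripartite.IsCompression Tc ∧ T = Tp + Tc ∧
        Tripartite.geometricRank Tp + Tripartite.geometricRank Tc =
          Tripartite.geometricRank T := by
  obtain ⟨n, hn⟩ := ENat.ne_top_iff_exists.1 hT.ne_top
  obtain ⟨Tp, Tc, r, k, hTp, hadd, hrk, hsr⟩ := Tripartite.exists_isPrimitive_add n T hn.symm
  have h1 := Tripartite.geometricRank_add_le Tp Tc
  have h2 := Tripartite.geometricRank_le_sliceRank Tc
  rw [← hadd, ← hn, hTp.1] at h1
  obtain ⟨m, hm⟩ := ENat.ne_top_iff_exists.1 (h2.trans_lt (ENat.natCast_lt_top _)).ne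
  rw [← hm] at h1 h2
  have h1' : n ≤ r + m := by exact_mod_cast h1
  have h2' : m ≤ Tripartite.sliceRank Tc := by exact_mod_cast h2
  -- The squeeze `r + k = n ≤ r + m` and `m ≤ SR(Tc) ≤ k` yields `m = SR(Tc) = k`.
  refine ⟨Tp, Tc, ⟨r, hTp⟩, ⟨m, hm.symm, by omega⟩, hadd, ?_⟩
  rw [hTp.1, ← hm, ← hn]
  norm_cast
  omega
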